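/- Let $\Bbbk=\mathbb{R}$ or $\mathbb{C}$, with $\langle x,y\rangle=x^*y$. For $d,n\in\mathbb{N}=\{1,2,\dots\}$ and a symmetric/Hermitian $n\times n$ matrix $A=(a_{ij})$ over $\Bbbk$, let $$\lVert A\rVert_{\gamma,d}^\Bbbk=\max\Bigl\{\Bigl|\sum_{i,j=1}^n a_{ij}\langle x_i,x_j\rangle\Bigr| : x_1,\dots,x_n\in\Bbbk^d,\ \lVert x_1\rVert=\dots=\lVert x_n\rVert=1\Bigr\},\qquad \lVert A\rVert_\gamma^\Bbbk=\lVert A\rVert_{\gamma,n}^\Bbbk .$$ Let $\mathbb{L}^n$ be the cone of weighted Laplacians, i.e. the real matrices $L_A=\operatorname{diag}(A\mathbb{1})-A$ with $A$ a real symmetric $n\times n$ matrix with zero diagonal and nonnegative entries. For $\mathsf{C}=\{\mathbb{L}^n:n\in\mathbb{N}\}$ put $$K_{\mathsf{C},d,p}^\Bbbk=\sup_{n\in\mathbb{N}}\ \sup_{0\ne L\in\mathbb{L}^n}\frac{\lVert L\rVert_{\gamma,p}^\Bbbk}{\lVert L\rVert_{\gamma,d}^\Bbbk}\quad(p\in\mathbb{N}),\qquad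 K_{\mathsf{C},d,\infty}^\Bbbk=\sup_{n\in\mathbb{N}}\ \sup_{0\ne L\in\mathbb{L}^n}\frac{\lVert L\rVert_{\gamma}^\Bbbk}{\lVert L\rVert_{\gamma,d}^\Bbbk},$$ and let the rank-$d$ Goemans–Williamson constant $K_{\mathsf{GW},d}^\Bbbk>0$ be the smallest positive constant $K$ such that $\lVert L\rVert_\gamma^\Bbbk\le K\,\lVert L\rVert_{\gamma,d}^\Bbbk$ for all $n\in\mathbb{N}$ and all $L\in\mathbb{L}^n$. For $z\in\Bbbk^d$ let $\operatorname{sgn} z=z/\lVert z\rVert$ if $z\ne0$ and $\operatorname{sgn}0=e_1$. Let $\varphi_d^\Bbbk$ be the function on the closed unit disc of $\Bbbk$ given by $$\varphi_d^\Bbbk(\langle u,v\rangle)=\int_{\Bbbk^{d\times n}}\bigl\langle\operatorname{sgn}(Zu),\operatorname{sgn}(Zv)\bigr\rangle\,G_{d,n}^\Bbbk(Z)\,dZ,\qquad u,v\in\Bbbk^n,\ \lVert u\rVert=\lVert v\rVert=1,\ n\ge2,$$ where $G_{d,n}^\mathbb{R}(Z)=(2\pi)^{-dn/2}e^{-\lVert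 Z\rVert^2/2}$ and $G_{d,n}^\mathbb{C}(Z)=\pi^{-dn}e^{-\lVert Z\rVert^2}$ with $\lVert\cdot\rVert$ the Frobenius norm; the integral depends only on $\langle u,v\rangle$, so that one may take $n=2$, $u=(1,0)$, $v=(x,\sqrt{1-|x|^2})$ to obtain $\varphi_d^\Bbbk(x)$. Put $$\alpha_d^\Bbbk=\inf_{0\le x\le1}\frac{1+\varphi_d^\Bbbk(x)}{1+x}.$$ Then for every $d\in\mathbb{N}$ and both $\Bbbk=\mathbb{R}$ and $\Bbbk=\mathbb{C}$, the smallest constant $K_{\mathsf{GW},d}^\Bbbk$ exists, and $$\lim_{p\to\infty}K_{\mathsf{C},d,p}^\Bbbk=K_{\mathsf{C},d,\infty}^\Bbbk=K_{\mathsf{GW},d}^\Bbbk\le\frac1{\alpha_d^\Bbbk}.$$ Moreover, $K_{\mathsf{GW},d}^\mathbb{C}=K_{\mathsf{GW},2d}^\mathbb{R}$. -/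

import Mathlib

open scoped ENNReal
open Filter Topology MeasureTheory

noncomputable section

namespace GW

/-! ### Grothendieck seminorms -/

/-- The `(γ,d)`-seminorm of an `n × n` matrix over `𝕜`: the maximum of `|∑ a_ij ⟨x_i, x_j⟩|` over all
unit vectors `x_1, …, x_n ∈ 𝕜^d` (Mathlib's inner product is conjugate-linear in the first slot). -/
def gammaRank (𝕜 : Type) [RCLike 𝕜] (d : ℕ) {n : ℕ} (A : Matrix (Fin n) (Fin n) 𝕜) : ℝ :=
  sSup {r : ℝ | ∃ x : Fin n → EuclideanSpace 𝕜 (Fin d), (∀ i, ‖x i‖ = 1) ∧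
    r = ‖∑ i, ∑ j, A i j * inner 𝕜 (x i) (x j)‖}

/-- The `γ`-seminorm of an `n × n` matrix: no constraint on the rank, so that vectors in `𝕜^n`
suffice. -/
def gammaNorm (𝕜 : Type) [RCLike 𝕜] {n : ℕ} (A : Matrix (Fin n) (Fin n) 𝕜) : ℝ :=
  gammaRank 𝕜 n A

/-! ### Conic Grothendieck constants -/

/-- `K_{C,d,p}`: the supremum over all `n` and all `A ∈ C n` of `‖A‖_{γ,p} / ‖A‖_{γ,d}`, in
`[0,∞]`, where `0 / 0 = 0` and `a / 0 = ∞` for `a > 0`. -/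
def conicConst (𝕜 : Type) [RCLike 𝕜] (C : (n : ℕ) → Set (Matrix (Fin n) (Fin n) 𝕜))
    (d p : ℕ) : ℝ≥0∞ :=
  ⨆ (n : ℕ), ⨆ A ∈ C n, ENNReal.ofReal (gammaRank 𝕜 p A) / ENNReal.ofReal (gammaRank 𝕜 d A)

/-- `K_{C,d,∞}`: the supremum over all `n` and all `A ∈ C n` of `‖A‖_γ / ‖A‖_{γ,d}`. -/
def conicConstTop (𝕜 : Type) [RCLike 𝕜] (C : (n : ℕ) → Set (Matrix (Fin n) (Fin n) 𝕜))
    (d : ℕ) : ℝ≥0∞ :=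
  ⨆ (n : ℕ), ⨆ A ∈ C n, ENNReal.ofReal (gammaNorm 𝕜 A) / ENNReal.ofReal (gammaRank 𝕜 d A)

/-! ### Weighted Laplacians and the rank-`d` Goemans–Williamson constant -/

/-- The cone of weighted Laplacians `L_A = diag(A𝟙) - A`, where `A` is a real symmetric matrix with
zero diagonal and nonnegative entries. -/
def laplacianCone (n : ℕ) : Set (Matrix (Fin n) (Fin n) ℝ) :=
  {L | ∃ A : Matrix (Fin n) (Fin n) ℝ, A.IsSymm ∧ (∀ i, A i i = 0) ∧ (∀ i j, 0 ≤ A i j) ∧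
    L = Matrix.diagonal (fun i => ∑ j, A i j) - A}

/-- A real matrix regarded as a matrix over `𝕜`. -/
def toField (𝕜 : Type) [RCLike 𝕜] {n : ℕ} (A : Matrix (Fin n) (Fin n) ℝ) :
    Matrix (Fin n) (Fin n) 𝕜 :=
  A.map (fun t : ℝ => (t : 𝕜))

/-- The family of cones of weighted Laplacians, regarded as matrices over `𝕜`. -/
def laplacianFamily (𝕜 : Type) [RCLike 𝕜] (n : ℕ) : Set (Matrix (Fin n) (Fin n) 𝕜) :=
  toField 𝕜 '' laplacianCone n

/-- The positive constants `K` such that `‖L‖_γ ≤ K ‖L‖_{γ,d}` for all `n` and all `n × n` weighted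
Laplacians `L`, with both seminorms taken over `𝕜`. -/
def gwBounds (𝕜 : Type) [RCLike 𝕜] (d : ℕ) : Set ℝ :=
  {K : ℝ | 0 < K ∧ ∀ (n : ℕ), ∀ L ∈ laplacianCone n,
    gammaNorm 𝕜 (toField 𝕜 L) ≤ K * gammaRank 𝕜 d (toField 𝕜 L)}

/-- The rank-`d` Goemans–Williamson constant: the sharpest constant in `gwBounds`. -/
def gwConst (𝕜 : Type) [RCLike 𝕜] (d : ℕ) : ℝ :=
  sInf (gwBounds 𝕜 d)

/-! ### The functions `φ_d` and the constants `α_d` -/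

/-- The sign of a vector: `z / ‖z‖` for `z ≠ 0`, and the first unit vector for `z = 0`. -/
def vecSign {𝕜 : Type} [RCLike 𝕜] {d : ℕ} (z : EuclideanSpace 𝕜 (Fin d)) :
    EuclideanSpace 𝕜 (Fin d) :=
  open Classical in
  if z = 0 then WithLp.toLp 2 (fun i => if (i : ℕ) = 0 then 1 else 0)
  else ((‖z‖⁻¹ : ℝ) : 𝕜) • z

/-- The product of the `d × n` matrix `Z` and the vector `u`. -/
def matVec {𝕜 : Type} [RCLike 𝕜] {d n : ℕ} (Z : Fin d → Fin n → 𝕜)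
    (u : EuclideanSpace 𝕜 (Fin n)) : EuclideanSpace 𝕜 (Fin d) :=
  WithLp.toLp 2 (fun i => ∑ j, Z i j * u j)

/-- The standard Gaussian density on real `d × n` matrices. -/
def gaussReal (d n : ℕ) (Z : Fin d → Fin n → ℝ) : ℝ :=
  (2 * Real.pi) ^ (-((d : ℝ) * n / 2)) * Real.exp (-(∑ i, ∑ j, ‖Z i j‖ ^ 2) / 2)

/-- The standard Gaussian density on complex `d × n` matrices. -/
def gaussComplex (d n : ℕ) (Z : Fin d → Fin n → ℂ) : ℝ :=
  Real.pi ^ (-((d : ℝ) * n)) * Real.exp (-(∑ i, ∑ j, ‖Z i j‖ ^ 2))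

/-- The integral `∫ ⟨sign (Z u), sign (Z v)⟩ G(Z) dZ` over all real `d × n` matrices. -/
def signIntegralReal (d : ℕ) {n : ℕ} (u v : EuclideanSpace ℝ (Fin n)) : ℝ :=
  ∫ Z : Fin d → Fin n → ℝ,
    inner ℝ (vecSign (matVec Z u)) (vecSign (matVec Z v)) * gaussReal d n Z

/-- The integral `∫ ⟨sign (Z u), sign (Z v)⟩ G(Z) dZ` over all complex `d × n` matrices. -/
def signIntegralComplex (d : ℕ) {n : ℕ} (u v : EuclideanSpace ℂ (Fin n)) : ℂ :=
  ∫ Z : Fin d → Fin n → ℂ,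
    inner ℂ (vecSign (matVec Z u)) (vecSign (matVec Z v)) * ((gaussComplex d n Z : ℝ) : ℂ)

/-- `φ_d` over `ℝ`, for `|x| ≤ 1`. The sign integral of unit vectors `u, v ∈ ℝ^n` depends on
`⟨u, v⟩` only, and `φ_d(⟨u, v⟩)` is its value; here it is taken at
`u = (1, 0)`, `v = (x, √(1 - x²))`. -/
def phiReal (d : ℕ) (x : ℝ) : ℝ :=
  signIntegralReal d !₂[(1 : ℝ), 0] !₂[x, √(1 - x ^ 2)]

/-- `φ_d` over `ℂ`, for `|x| ≤ 1`, taken at `u = (1, 0)`, `v = (x, √(1 - |x|²))`. -/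
def phiComplex (d : ℕ) (x : ℂ) : ℂ :=
  signIntegralComplex d !₂[(1 : ℂ), 0] !₂[x, ((√(1 - ‖x‖ ^ 2) : ℝ) : ℂ)]

/-- `α_d` over `ℝ`. -/
def alphaReal (d : ℕ) : ℝ :=
  ⨅ x : Set.Icc (0 : ℝ) 1, (1 + phiReal d (x : ℝ)) / (1 + (x : ℝ))

/-- `α_d` over `ℂ` (the values of `φ_d` over `ℂ` at real arguments are real, so that taking the real
part does not change them). -/
def alphaComplex (d : ℕ) : ℝ :=
  ⨅ x : Set.Icc (0 : ℝ) 1, (1 + (phiComplex d ((x : ℝ) : ℂ)).re) / (1 + (x : ℝ))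

end GW

end

/-! On unit vectors the form of a Laplacian equals `∑ a_ij (1 - Re ⟨x_i, x_j⟩)`, which is
nonnegative and depends only on the real parts of the Gram matrix. Hence `ℂ^d` may be replaced by
`ℝ^(2d)`, which relates the two fields.

The bound `1 / α_d` comes from random rounding. View the `x_i` as real unit vectors `u_i` and
multiply them by a Gaussian matrix `Z` over `𝕜` with `d` rows. The vectors `sgn (Z u_i)` are
admissible in rank `d`, and their expected Gram form has entries `φ(t_ij)`, where `t_ij = Re ⟨x_i,
x_j⟩`. It remains to see that `α (1 - t) ≤ 1 - φ(t)` on `[-1, 1]` (`signAlpha_mul_le`). For `t ≤ 0`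
this is the definition of `α` and oddness of `φ`; for `t ≥ 0` it needs `φ(t) ≤ t`. No formula for
`φ` is used there: `φ` is positive definite on spheres of every dimension, with `φ(0) = 0` and `φ(1)
= 1`, and `SpherePosDef.le_self` draws the bound from this alone.

Both fields are treated at once through `IsQuadraticLaw`. The limit in `p` is an exchange of
suprema. -/

namespace GW

/-! ### Laplacian forms -/

section Laplacian

variable {𝕜 : Type} [RCLike 𝕜]

/-- The Laplacian form `∑ a_ij (1 - Re ⟨x_i, x_j⟩)`. -/
noncomputable def cutValue (𝕜 : Type) [RCLike 𝕜] {E : Type*} [NormedAddCommGroup E]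
    [InnerProductSpace 𝕜 E] {n : ℕ} (A : Matrix (Fin n) (Fin n) ℝ) (x : Fin n → E) : ℝ :=
  ∑ i, ∑ j, A i j * (1 - RCLike.re (inner 𝕜 (x i) (x j)))

/-- The weighted Laplacian of a weight matrix. -/
noncomputable def laplacian {n : ℕ} (A : Matrix (Fin n) (Fin n) ℝ) : Matrix (Fin n) (Fin n) ℝ :=
  Matrix.diagonal (fun i => ∑ j, A i j) - A

/-- As `‖x_i‖ = 1`, the diagonal contributes exactly the row sums. The total is real because
conjugation swaps `i` and `j` and `A` is symmetric. -/
lemma laplacian_quadratic_eq {E : Type*} [NormedAddCommGroup E] [InnerProductSpace 𝕜 E] {n : ℕ}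
    {A : Matrix (Fin n) (Fin n) ℝ} (hs : A.IsSymm) {x : Fin n → E} (hx : ∀ i, ‖x i‖ = 1) :
    ∑ i, ∑ j, toField 𝕜 (laplacian A) i j * inner 𝕜 (x i) (x j) = (cutValue 𝕜 A x : 𝕜) := by
  have h1 : ∑ i, ∑ j, toField 𝕜 (laplacian A) i j * inner 𝕜 (x i) (x j) =
      ∑ i, ∑ j, (A i j : 𝕜) * (1 - inner 𝕜 (x i) (x j)) := by
    refine Finset.sum_congr rfl fun i _ => ?_
    simp only [toField, laplacian, Matrix.map_apply, Matrix.sub_apply, Matrix.diagonal_apply,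
      RCLike.ofReal_sub, sub_mul, Finset.sum_sub_distrib, mul_sub, mul_one]
    congr 1
    rw [Finset.sum_eq_single i]
    · simp [inner_self_eq_norm_sq_to_K, hx]
    · intro j _ hj
      simp [Ne.symm hj]
    · simp
  rw [h1]
  symm
  have h2 : cutValue 𝕜 A x =
      RCLike.re (∑ i, ∑ j, (A i j : 𝕜) * (1 - inner 𝕜 (x i) (x j))) := by
    simp [cutValue]
  rw [h2, ← RCLike.conj_eq_iff_re]
  simp only [map_sum, map_mul, map_sub, RCLike.conj_ofReal, inner_conj_symm, map_one]
  rw [Finset.sum_comm]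
  refine Finset.sum_congr rfl fun i _ => Finset.sum_congr rfl fun j _ => ?_
  rw [hs.apply]

lemma re_inner_le_one {E : Type*} [NormedAddCommGroup E] [InnerProductSpace 𝕜 E] {x y : E}
    (hx : ‖x‖ = 1) (hy : ‖y‖ = 1) : |RCLike.re (inner 𝕜 x y)| ≤ 1 := by
  have := (RCLike.abs_re_le_norm (inner 𝕜 x y)).trans (norm_inner_le_norm x y)
  simpa [hx, hy] using this

lemma cutValue_nonneg {E : Type*} [NormedAddCommGroup E] [InnerProductSpace 𝕜 E] {n : ℕ}
    {A : Matrix (Fin n) (Fin n) ℝ} (hA : ∀ i j, 0 ≤ A i j) {x : Fin n → E}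
    (hx : ∀ i, ‖x i‖ = 1) : 0 ≤ cutValue 𝕜 A x :=
  Finset.sum_nonneg fun i _ => Finset.sum_nonneg fun j _ => mul_nonneg (hA i j) <| by
    have := (abs_le.1 (re_inner_le_one (𝕜 := 𝕜) (hx i) (hx j))).2
    linarith

/-- Supplies the boundedness without which the `sSup` in `gammaRank` would be a default value. -/
lemma cutValue_le {E : Type*} [NormedAddCommGroup E] [InnerProductSpace 𝕜 E] {n : ℕ}
    {A : Matrix (Fin n) (Fin n) ℝ} (hA : ∀ i j, 0 ≤ A i j) {x : Fin n → E}
    (hx : ∀ i, ‖x i‖ = 1) : cutValue 𝕜 A x ≤ ∑ i, ∑ j, A i j * 2 :=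
  Finset.sum_le_sum fun i _ => Finset.sum_le_sum fun j _ =>
    mul_le_mul_of_nonneg_left (by
      have := (abs_le.1 (re_inner_le_one (𝕜 := 𝕜) (hx i) (hx j))).1
      linarith) (hA i j)

lemma gammaRank_nonneg (d : ℕ) {n : ℕ} (A : Matrix (Fin n) (Fin n) 𝕜) : 0 ≤ gammaRank 𝕜 d A := by
  refine Real.sSup_nonneg ?_
  rintro r ⟨x, -, rfl⟩
  exact norm_nonneg _

lemma norm_laplacian_quadratic {E : Type*} [NormedAddCommGroup E] [InnerProductSpace 𝕜 E] {n : ℕ}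
    {A : Matrix (Fin n) (Fin n) ℝ} (hs : A.IsSymm) (hA : ∀ i j, 0 ≤ A i j)
    {x : Fin n → E} (hx : ∀ i, ‖x i‖ = 1) :
    ‖∑ i, ∑ j, toField 𝕜 (laplacian A) i j * inner 𝕜 (x i) (x j)‖ = cutValue 𝕜 A x := by
  rw [laplacian_quadratic_eq hs hx, RCLike.norm_ofReal, abs_of_nonneg (cutValue_nonneg hA hx)]

lemma cutValue_le_gammaRank {d n : ℕ} {A : Matrix (Fin n) (Fin n) ℝ} (hs : A.IsSymm)
    (hA : ∀ i j, 0 ≤ A i j) {x : Fin n → EuclideanSpace 𝕜 (Fin d)} (hx : ∀ i, ‖x i‖ = 1) :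
    cutValue 𝕜 A x ≤ gammaRank 𝕜 d (toField 𝕜 (laplacian A)) := by
  refine le_csSup ⟨∑ i, ∑ j, A i j * 2, ?_⟩ ⟨x, hx, (norm_laplacian_quadratic hs hA hx).symm⟩
  rintro r ⟨y, hy, rfl⟩
  rw [norm_laplacian_quadratic hs hA hy]
  exact cutValue_le hA hy

/-- Nonnegativity of `C` covers `d = 0 < n`, where there are no unit vectors and `sSup ∅ = 0`. -/
lemma gammaRank_le {d n : ℕ} {A : Matrix (Fin n) (Fin n) ℝ} (hs : A.IsSymm)
    (hA : ∀ i j, 0 ≤ A i j) {C : ℝ} (hC : 0 ≤ C)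
    (h : ∀ x : Fin n → EuclideanSpace 𝕜 (Fin d), (∀ i, ‖x i‖ = 1) → cutValue 𝕜 A x ≤ C) :
    gammaRank 𝕜 d (toField 𝕜 (laplacian A)) ≤ C := by
  refine Real.sSup_le ?_ hC
  rintro r ⟨y, hy, rfl⟩
  rw [norm_laplacian_quadratic hs hA hy]
  exact h y hy

/-- Comparison of seminorms of Laplacians through maps preserving the real parts of Gram matrices. -/
lemma gammaRank_le_gammaRank {𝕜' : Type} [RCLike 𝕜'] {p q n : ℕ} {A : Matrix (Fin n) (Fin n) ℝ}
    (hs : A.IsSymm) (hA : ∀ i j, 0 ≤ A i j)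
    (h : ∀ x : Fin n → EuclideanSpace 𝕜 (Fin p), ∃ y : Fin n → EuclideanSpace 𝕜' (Fin q),
      ∀ i j, RCLike.re (inner 𝕜' (y i) (y j)) = RCLike.re (inner 𝕜 (x i) (x j))) :
    gammaRank 𝕜 p (toField 𝕜 (laplacian A)) ≤ gammaRank 𝕜' q (toField 𝕜' (laplacian A)) := by
  refine gammaRank_le hs hA (gammaRank_nonneg _ _) fun x hx => ?_
  obtain ⟨y, hy⟩ := h x
  have hy1 : ∀ i, ‖y i‖ = 1 := fun i => by
    rw [norm_eq_sqrt_re_inner (𝕜 := 𝕜'), hy, ← norm_eq_sqrt_re_inner, hx]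
  have : cutValue 𝕜 A x = cutValue 𝕜' A y := by simp only [cutValue, hy]
  rw [this]
  exact cutValue_le_gammaRank hs hA hy1

lemma gammaRank_mono {p q n : ℕ} (hpq : p ≤ q) {A : Matrix (Fin n) (Fin n) ℝ}
    (hs : A.IsSymm) (hA : ∀ i j, 0 ≤ A i j) :
    gammaRank 𝕜 p (toField 𝕜 (laplacian A)) ≤ gammaRank 𝕜 q (toField 𝕜 (laplacian A)) := by
  refine gammaRank_le_gammaRank hs hA fun x =>
    ⟨fun i => WithLp.toLp 2 fun k => if h : (k : ℕ) < p then x i ⟨k, h⟩ else 0, fun i j => ?_⟩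
  congr 1
  simp only [PiLp.inner_apply]
  refine (Finset.sum_of_injOn (Fin.castLE hpq) (Fin.castLE_injective hpq).injOn
    (by simp) (fun k _ hk => ?_) fun k _ => by simp).symm
  have : ¬ (k : ℕ) < p := fun h => hk ⟨⟨k, h⟩, by simp⟩
  simp [this]

/-- Any `n` vectors have the Gram matrix of `n` vectors in `𝕜^n`. -/
lemma exists_gram_eq {E : Type*} [NormedAddCommGroup E] [InnerProductSpace 𝕜 E] {n : ℕ}
    (x : Fin n → E) : ∃ y : Fin n → EuclideanSpace 𝕜 (Fin n),
      ∀ i j, inner 𝕜 (y i) (y j) = inner 𝕜 (x i) (x j) := by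
  open scoped ComplexOrder MatrixOrder Matrix.Norms.L2Operator in
  -- The Gram matrix is positive semidefinite, hence of the form `B* B`; the columns of `B` are the
  -- required vectors.
  obtain ⟨B, hB⟩ := CStarAlgebra.nonneg_iff_eq_star_mul_self.mp
    (Matrix.posSemidef_gram 𝕜 x).nonneg
  refine ⟨fun i => WithLp.toLp 2 fun k => B k i, fun i j => ?_⟩
  rw [← Matrix.gram_apply (𝕜 := 𝕜) (v := x), hB, Matrix.star_eq_conjTranspose, Matrix.mul_apply]
  simp [PiLp.inner_apply, mul_comm]

lemma gammaRank_le_gammaNorm {p n : ℕ} {A : Matrix (Fin n) (Fin n) ℝ}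
    (hs : A.IsSymm) (hA : ∀ i j, 0 ≤ A i j) :
    gammaRank 𝕜 p (toField 𝕜 (laplacian A)) ≤ gammaNorm 𝕜 (toField 𝕜 (laplacian A)) :=
  gammaRank_le_gammaRank hs hA fun x => (exists_gram_eq x).imp fun y hy i j => by rw [hy]

lemma gammaRank_complex_eq {d n : ℕ} {A : Matrix (Fin n) (Fin n) ℝ}
    (hs : A.IsSymm) (hA : ∀ i j, 0 ≤ A i j) :
    gammaRank ℂ d (toField ℂ (laplacian A)) = gammaRank ℝ (2 * d) (toField ℝ (laplacian A)) := by
  apply le_antisymm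
  · refine gammaRank_le_gammaRank hs hA fun x => ⟨fun i => WithLp.toLp 2 fun k =>
      if (finProdFinEquiv.symm k).1 = 0 then (x i (finProdFinEquiv.symm k).2).re
      else (x i (finProdFinEquiv.symm k).2).im, fun i j => ?_⟩
    simp only [PiLp.inner_apply]
    rw [← finProdFinEquiv.sum_comp]
    simp [Fintype.sum_prod_type, Fin.sum_univ_two, ← Finset.sum_add_distrib]
  · refine gammaRank_le_gammaRank hs hA fun x => ⟨fun i => WithLp.toLp 2 fun k =>
      ⟨x i (finProdFinEquiv (0, k)), x i (finProdFinEquiv (1, k))⟩, fun i j => ?_⟩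
    simp only [PiLp.inner_apply]
    conv_rhs => rw [← finProdFinEquiv.sum_comp]
    simp [Fintype.sum_prod_type, Fin.sum_univ_two, ← Finset.sum_add_distrib]

/-- `ℂ^n` amounts to `ℝ^(2n)`, but `n` real vectors already fit in `ℝ^n`. -/
lemma gammaNorm_complex_eq {n : ℕ} {A : Matrix (Fin n) (Fin n) ℝ}
    (hs : A.IsSymm) (hA : ∀ i j, 0 ≤ A i j) :
    gammaNorm ℂ (toField ℂ (laplacian A)) = gammaNorm ℝ (toField ℝ (laplacian A)) :=
  (gammaRank_complex_eq hs hA).trans <|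
    (gammaRank_le_gammaNorm hs hA).antisymm (gammaRank_mono (by lia) hs hA)

lemma gwBounds_complex_eq (d : ℕ) : gwBounds ℂ d = gwBounds ℝ (2 * d) := by
  refine Set.ext fun K => and_congr_right fun _ => forall_congr' fun n =>
    forall₂_congr fun L hL => ?_
  obtain ⟨A, hs, -, hA, rfl⟩ := hL
  have h1 := gammaNorm_complex_eq hs hA
  have h2 := gammaRank_complex_eq (d := d) hs hA
  simp only [laplacian] at h1 h2
  rw [h1, h2]

end Laplacian

/-! ### Positive definite functions of the inner product -/

section PositiveDefinite

/-- `φ` is positive definite on all spheres: the matrices `φ(⟨u_i, u_j⟩)` of unit vectors are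
positive semidefinite. -/
def SpherePosDef (φ : ℝ → ℝ) : Prop :=
  ∀ (s ι : Type) [Fintype s] [Fintype ι] (u : s → ι → ℝ) (_ : ∀ a, ∑ k, u a k ^ 2 = 1) (c : s → ℝ),
    0 ≤ ∑ a, ∑ b, c a * c b * φ (∑ k, u a k * u b k)

variable {φ : ℝ → ℝ}

/-- Positivity is tested on one vector `e` with coefficient `-N φ(t)` and `N` vectors `v_i` with
coefficient `1`, where `⟨e, v_i⟩ = t` and `⟨v_i, v_j⟩ = p` for `i ≠ j`. -/
lemma SpherePosDef.mul_sq_le (h : SpherePosDef φ) (h1 : φ 1 = 1) {N : ℕ} (hN : 0 < N) {t p : ℝ}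
    {ι : Type} [Fintype ι] (u : Option (Fin N) → ι → ℝ)
    (h00 : ∑ k, u none k * u none k = 1) (h01 : ∀ i, ∑ k, u none k * u (some i) k = t)
    (h11 : ∀ i j, ∑ k, u (some i) k * u (some j) k = if i = j then 1 else p) :
    N * φ t ^ 2 ≤ 1 + (N - 1) * φ p := by
  have hu : ∀ a, ∑ k, u a k ^ 2 = 1 := by
    rintro (_ | i)
    · simpa only [sq] using h00
    · simpa only [sq, if_true] using h11 i i
  have h10 : ∀ i, ∑ k, u (some i) k * u none k = t := fun i => by
    rw [← h01 i]; exact Finset.sum_congr rfl fun k _ => mul_comm _ _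
  have h11' : ∀ i j, φ (∑ k, u (some i) k * u (some j) k) =
      φ p + if i = j then 1 - φ p else 0 := by
    intro i j
    rw [h11]
    split_ifs <;> simp [h1]
  have key := h _ _ u hu (fun a => a.elim (-(N * φ t)) fun _ => 1)
  simp only [Fintype.sum_option, Option.elim_none, Option.elim_some, h00, h01, h10, h1, h11'] at key
  simp [Finset.sum_add_distrib] at key
  have hN' : (0 : ℝ) < N := by exact_mod_cast hN
  have : 0 ≤ (N : ℝ) * (1 + (N - 1) * φ p - N * φ t ^ 2) := by linarith
  have := nonneg_of_mul_nonneg_right this hN'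
  linarith

/-- The vectors `v_i = t e + √(1 - t²) f_i`, with `e, f_1, …, f_N` orthonormal, have `p = t²`.
Divide by `N` and let `N → ∞`. -/
lemma SpherePosDef.sq_le (h : SpherePosDef φ) (h1 : φ 1 = 1) {t : ℝ} (ht : |t| ≤ 1) :
    φ t ^ 2 ≤ φ (t ^ 2) := by
  have hs : √(1 - t ^ 2) * √(1 - t ^ 2) = 1 - t ^ 2 :=
    Real.mul_self_sqrt (by nlinarith [sq_abs t, abs_nonneg t])
  have key : ∀ N : ℕ, 0 < N → (N : ℝ) * φ t ^ 2 ≤ 1 + (N - 1) * φ (t ^ 2) := by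
    intro N hN
    refine h.mul_sq_le h1 hN (ι := Option (Fin N)) (fun a => a.elim
      (fun k => k.elim 1 fun _ => 0)
      (fun i k => k.elim t fun j => if i = j then √(1 - t ^ 2) else 0)) ?_ ?_ ?_
    · simp
    · simp
    · intro i j
      by_cases hij : i = j
      · subst hij
        simp [hs]; ring
      · simp [hij]; ring
  by_contra! hlt
  obtain ⟨N, hN⟩ := exists_nat_gt (|1 - φ (t ^ 2)| / (φ t ^ 2 - φ (t ^ 2)))
  rw [div_lt_iff₀ (by linarith)] at hN
  have hN0 : 0 < N := by
    rcases Nat.eq_zero_or_pos N with rfl | h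
    · have := abs_nonneg (1 - φ (t ^ 2)); simp at hN; linarith
    · exact h
  have := key N hN0
  have := le_abs_self (1 - φ (t ^ 2))
  linarith

lemma SpherePosDef.nonneg (h : SpherePosDef φ) (h1 : φ 1 = 1) {t : ℝ} (h0t : 0 ≤ t) (ht : t ≤ 1) :
    0 ≤ φ t := by
  have := h.sq_le h1 (t := √t) (by rw [abs_of_nonneg (Real.sqrt_nonneg _)]; simpa using ht)
  rw [Real.sq_sqrt h0t] at this
  exact (sq_nonneg _).trans this

/-- A Bessel inequality: with orthonormal `v_i` and `e` having `N` coordinates equal to `t`, one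
gets `N φ(t)² ≤ 1`. The largest possible `N = ⌊1/t²⌋` is at least `1/(2t²)`. -/
lemma SpherePosDef.sq_le_two_mul_sq (h : SpherePosDef φ) (h0 : φ 0 = 0) (h1 : φ 1 = 1) {t : ℝ}
    (h0t : 0 < t) (ht : t ≤ 1) : φ t ^ 2 ≤ 2 * t ^ 2 := by
  set N := ⌊1 / t ^ 2⌋₊ with hNdef
  have ht2 : 0 < t ^ 2 := by positivity
  have hx : 1 ≤ 1 / t ^ 2 := by rw [le_div_iff₀ ht2]; nlinarith
  have hN : 0 < N := Nat.floor_pos.2 hx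
  have hN1 : (N : ℝ) * t ^ 2 ≤ 1 := by
    rw [← le_div_iff₀ ht2]; exact Nat.floor_le (by positivity)
  have hN2 : 1 ≤ 2 * (N * t ^ 2) := by
    have h3 := Nat.lt_floor_add_one (1 / t ^ 2)
    rw [← hNdef, div_lt_iff₀ ht2] at h3
    have h4 : (1 : ℝ) ≤ N := by exact_mod_cast hN
    nlinarith
  have hs : √(1 - N * t ^ 2) * √(1 - N * t ^ 2) = 1 - N * t ^ 2 :=
    Real.mul_self_sqrt (by linarith)
  have key := h.mul_sq_le h1 hN (t := t) (p := 0) (ι := Option (Fin N)) (fun a => a.elim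
      (fun k => k.elim (√(1 - N * t ^ 2)) fun _ => t)
      (fun i k => k.elim 0 fun j => if i = j then 1 else 0))
      (by simp [hs]; ring) (by simp) (by intro i j; simp)
  rw [h0, mul_zero, add_zero] at key
  have : φ t ^ 2 * 1 ≤ φ t ^ 2 * (2 * (N * t ^ 2)) := mul_le_mul_of_nonneg_left hN2 (sq_nonneg _)
  nlinarith [mul_le_mul_of_nonneg_right key (by positivity : 0 ≤ 2 * t ^ 2)]

lemma SpherePosDef.pow_le (h : SpherePosDef φ) (h1 : φ 1 = 1) {t : ℝ} (h0t : 0 ≤ t) (ht : t ≤ 1)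
    (k : ℕ) : φ t ^ 2 ^ k ≤ φ (t ^ 2 ^ k) := by
  induction k with
  | zero => simp
  | succ k ih =>
    rw [pow_succ, pow_mul, pow_mul]
    refine (pow_le_pow_left₀ (pow_nonneg (h.nonneg h1 h0t ht) _) ih 2).trans (h.sq_le h1 ?_)
    rw [abs_of_nonneg (by positivity)]
    exact pow_le_one₀ h0t ht

/-- A normalized positive definite function vanishing at `0` lies below the identity. -/
lemma SpherePosDef.le_self (h : SpherePosDef φ) (h0 : φ 0 = 0) (h1 : φ 1 = 1) {t : ℝ}
    (h0t : 0 ≤ t) (ht : t ≤ 1) : φ t ≤ t := by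
  rcases h0t.eq_or_lt with rfl | hpos
  · rw [h0]
  by_contra! hlt
  have hr : 1 < φ t / t := (one_lt_div hpos).2 hlt
  obtain ⟨n, hn⟩ := pow_unbounded_of_one_lt 2 hr
  -- Power trick: the crude bound at `t^(2^n)` gives `(φ(t)/t)^(2^(n+1)) ≤ 2`, while `n` was chosen
  -- with `(φ(t)/t)^n > 2`.
  have h2 : (φ t ^ 2 ^ n) ^ 2 ≤ 2 * (t ^ 2 ^ n) ^ 2 :=
    (pow_le_pow_left₀ (pow_nonneg (h.nonneg h1 h0t ht) _) (h.pow_le h1 h0t ht n) 2).trans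
      (h.sq_le_two_mul_sq h0 h1 (by positivity) (pow_le_one₀ h0t ht))
  rw [← pow_mul, ← pow_mul, ← div_le_iff₀ (by positivity), ← div_pow] at h2
  have h3 : (φ t / t) ^ n ≤ (φ t / t) ^ (2 ^ n * 2) :=
    pow_le_pow_right₀ hr.le (by have := @Nat.lt_two_pow_self n; lia)
  linarith

end PositiveDefinite

/-! ### The sign vectors of Gaussian matrices -/

section Sign

variable {𝕜 : Type} [RCLike 𝕜] {d : ℕ}

lemma norm_vecSign (hd : 1 ≤ d) (z : EuclideanSpace 𝕜 (Fin d)) : ‖vecSign z‖ = 1 := by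
  unfold vecSign
  split_ifs with h
  · rw [EuclideanSpace.norm_eq, Finset.sum_eq_single (⟨0, hd⟩ : Fin d)]
    · simp
    · intro j _ hj
      have : (j : ℕ) ≠ 0 := fun h => hj (Fin.ext h)
      simp [this]
    · simp
  · rw [norm_smul, RCLike.norm_ofReal, abs_of_nonneg (by positivity),
      inv_mul_cancel₀ (norm_ne_zero_iff.2 h)]

lemma vecSign_neg {z : EuclideanSpace 𝕜 (Fin d)} (hz : z ≠ 0) : vecSign (-z) = -vecSign z := by
  simp [vecSign, hz]

variable {ι κ : Type} [Fintype ι] [Fintype κ]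

/-- The map `z ↦ (⟨u, z⟩, ⟨v, z⟩)`. -/
noncomputable def pairMap (𝕜 : Type) [RCLike 𝕜] (u v : ι → ℝ) : (ι → 𝕜) →L[ℝ] 𝕜 × 𝕜 :=
  (∑ j, u j • ContinuousLinearMap.proj (R := ℝ) j).prod
    (∑ j, v j • ContinuousLinearMap.proj (R := ℝ) j)

lemma pairMap_apply (u v : ι → ℝ) (z : ι → 𝕜) :
    pairMap 𝕜 u v z = (∑ j, z j * (u j : 𝕜), ∑ j, z j * (v j : 𝕜)) := by
  simp [pairMap, RCLike.real_smul_eq_coe_mul, mul_comm]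

variable [MeasurableSpace 𝕜]

/-- The sign of the product of a matrix over `𝕜` and a real vector. -/
noncomputable def signVec (u : ι → ℝ) (Z : Fin d → ι → 𝕜) : EuclideanSpace 𝕜 (Fin d) :=
  vecSign (WithLp.toLp 2 fun i => ∑ j, Z i j * (u j : 𝕜))

/-- The expected real inner product of the sign vectors of `Z u` and `Z v`, for a matrix `Z` with
independent entries of law `γ`. -/
noncomputable def signCorr (γ : Measure 𝕜) (d : ℕ) (u v : ι → ℝ) : ℝ :=
  ∫ Z : Fin d → ι → 𝕜, RCLike.re (inner 𝕜 (signVec u Z) (signVec v Z))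
    ∂(Measure.pi fun _ => Measure.pi fun _ => γ)

/-- A law on `𝕜` whose characteristic function is the exponential of a quadratic form, without atom
at `0`. -/
structure IsQuadraticLaw (γ : Measure 𝕜) : Prop where
  isProbability : IsProbabilityMeasure γ
  zero_atom : γ {0} = 0
  charFunDual_eq : ∃ B : StrongDual ℝ 𝕜 →ₗ[ℝ] StrongDual ℝ 𝕜 →ₗ[ℝ] ℝ,
    ∀ l, charFunDual γ l = Complex.exp ((B l l : ℝ) : ℂ)

variable {γ : Measure 𝕜}

lemma signCorr_self (hγ : IsQuadraticLaw γ) (hd : 1 ≤ d) (u : ι → ℝ) : signCorr γ d u u = 1 := by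
  have := hγ.isProbability
  simp [signCorr, inner_self_eq_norm_sq_to_K, norm_vecSign hd, signVec]

variable [BorelSpace 𝕜]

lemma measurable_vecSign :
    Measurable (vecSign : EuclideanSpace 𝕜 (Fin d) → EuclideanSpace 𝕜 (Fin d)) := by
  unfold vecSign
  refine Measurable.ite (measurableSet_singleton 0) measurable_const ?_
  have h : Measurable fun z : EuclideanSpace 𝕜 (Fin d) => ((‖z‖⁻¹ : ℝ) : 𝕜) :=
    (RCLike.continuous_ofReal (K := 𝕜)).measurable.comp measurable_norm.inv
  exact h.smul measurable_id

lemma measurable_signVec (u : ι → ℝ) :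
    Measurable (signVec u : (Fin d → ι → 𝕜) → EuclideanSpace 𝕜 (Fin d)) :=
  measurable_vecSign.comp <| (WithLp.measurable_toLp 2 _).comp (by fun_prop)

/-- By independence the exponents of the coordinates add up, and the sum of the quadratic forms
involves `u, v` only through their Gram matrix. The index types may differ, which permits reduction
to dimension two or one. -/
lemma IsQuadraticLaw.map_pairMap_eq (hγ : IsQuadraticLaw γ) {u v : ι → ℝ} {u' v' : κ → ℝ}
    (huu : ∑ j, u j * u j = ∑ j, u' j * u' j) (huv : ∑ j, u j * v j = ∑ j, u' j * v' j)
    (hvv : ∑ j, v j * v j = ∑ j, v' j * v' j) :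
    (Measure.pi fun _ : ι => γ).map (pairMap 𝕜 u v) =
      (Measure.pi fun _ : κ => γ).map (pairMap 𝕜 u' v') := by
  classical
  have := hγ.isProbability
  have h1 : IsProbabilityMeasure ((Measure.pi fun _ : ι => γ).map (pairMap 𝕜 u v)) :=
    Measure.isProbabilityMeasure_map (by fun_prop)
  have h2 : IsProbabilityMeasure ((Measure.pi fun _ : κ => γ).map (pairMap 𝕜 u' v')) :=
    Measure.isProbabilityMeasure_map (by fun_prop)
  obtain ⟨B, hB⟩ := hγ.charFunDual_eq
  have key : ∀ {τ : Type} [Fintype τ] [DecidableEq τ] (a b : τ → ℝ) (L : StrongDual ℝ (𝕜 × 𝕜)),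
      charFunDual ((Measure.pi fun _ : τ => γ).map (pairMap 𝕜 a b)) L = Complex.exp
        (((∑ j, a j * a j) * B (L.comp (.inl ℝ 𝕜 𝕜)) (L.comp (.inl ℝ 𝕜 𝕜)) +
          (∑ j, a j * b j) * (B (L.comp (.inl ℝ 𝕜 𝕜)) (L.comp (.inr ℝ 𝕜 𝕜)) +
            B (L.comp (.inr ℝ 𝕜 𝕜)) (L.comp (.inl ℝ 𝕜 𝕜))) +
          (∑ j, b j * b j) * B (L.comp (.inr ℝ 𝕜 𝕜)) (L.comp (.inr ℝ 𝕜 𝕜)) : ℝ) : ℂ) := by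
    intro τ _ _ a b L
    have hsingle : ∀ j, (L.comp (pairMap 𝕜 a b)).comp (.single ℝ (fun _ : τ => 𝕜) j) =
        a j • L.comp (.inl ℝ 𝕜 𝕜) + b j • L.comp (.inr ℝ 𝕜 𝕜) := by
      intro j
      ext z
      have : pairMap 𝕜 a b (Pi.single j z) = a j • (z, 0) + b j • (0, z) := by
        rw [pairMap_apply]
        simp [Pi.single_apply, RCLike.real_smul_eq_coe_mul, mul_comm]
      change L (pairMap 𝕜 a b (Pi.single j z)) = a j • L (z, 0) + b j • L (0, z)
      rw [this, map_add, map_smul, map_smul]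
    rw [charFunDual_map, charFunDual_pi]
    simp only [hsingle, hB]
    rw [← Complex.exp_sum, ← Complex.ofReal_sum]
    congr 2
    simp only [map_add, map_smul, LinearMap.add_apply, LinearMap.smul_apply, smul_eq_mul,
      Finset.sum_mul, ← Finset.sum_add_distrib]
    exact Finset.sum_congr rfl fun j _ => by ring
  refine Measure.ext_of_charFunDual (funext fun L => ?_)
  rw [key, key, huu, huv, hvv]

lemma signCorr_eq_integral (hγ : IsQuadraticLaw γ) (u v : ι → ℝ) :
    signCorr γ d u v = ∫ w : Fin d → 𝕜 × 𝕜,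
      RCLike.re (inner 𝕜 (vecSign (WithLp.toLp 2 fun i => (w i).1))
        (vecSign (WithLp.toLp 2 fun i => (w i).2)))
      ∂(Measure.pi fun _ => (Measure.pi fun _ : ι => γ).map (pairMap 𝕜 u v)) := by
  have := hγ.isProbability
  have h1 : IsProbabilityMeasure ((Measure.pi fun _ : ι => γ).map (pairMap 𝕜 u v)) :=
    Measure.isProbabilityMeasure_map (by fun_prop)
  rw [← Measure.pi_map_pi (f := fun _ => pairMap 𝕜 u v) (fun _ => (pairMap 𝕜 u v).measurable.aemeasurable),
    integral_map]
  · simp only [pairMap_apply, signCorr, signVec]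
  · exact (measurable_pi_lambda _ fun i => (pairMap 𝕜 u v).measurable.comp
      (measurable_pi_apply i)).aemeasurable
  · refine Measurable.aestronglyMeasurable ?_
    refine RCLike.measurable_re.comp (Measurable.inner ?_ ?_) <;>
    exact measurable_vecSign.comp <| (WithLp.measurable_toLp 2 _).comp (by fun_prop)

lemma signCorr_congr (hγ : IsQuadraticLaw γ) {u v : ι → ℝ} {u' v' : κ → ℝ}
    (huu : ∑ j, u j * u j = ∑ j, u' j * u' j) (huv : ∑ j, u j * v j = ∑ j, u' j * v' j)
    (hvv : ∑ j, v j * v j = ∑ j, v' j * v' j) :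
    signCorr γ d u v = signCorr γ d u' v' := by
  rw [signCorr_eq_integral hγ, signCorr_eq_integral hγ, hγ.map_pairMap_eq huu huv hvv]

/-- A single coordinate of `Z u` suffices: as `u` is a unit vector, it has law `γ`, as seen by
comparison with the vector `1` in dimension one. -/
lemma ae_mulVec_ne_zero (hγ : IsQuadraticLaw γ) (hd : 1 ≤ d) {u : ι → ℝ}
    (hu : ∑ j, u j * u j = 1) :
    ∀ᵐ Z : Fin d → ι → 𝕜 ∂(Measure.pi fun _ => Measure.pi fun _ => γ),
      (WithLp.toLp 2 fun i => ∑ j, Z i j * (u j : 𝕜) : EuclideanSpace 𝕜 (Fin d)) ≠ 0 := by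
  have := hγ.isProbability
  have hrow : ∀ᵐ z : ι → 𝕜 ∂(Measure.pi fun _ => γ), (pairMap 𝕜 u u z).1 ≠ 0 := by
    have hms : MeasurableSet {w : 𝕜 × 𝕜 | w.1 ≠ 0} :=
      measurable_fst (measurableSet_singleton (0 : 𝕜)).compl
    rw [← ae_map_iff (p := fun w : 𝕜 × 𝕜 => w.1 ≠ 0) (by fun_prop) hms,
      hγ.map_pairMap_eq (u' := fun _ : Unit => 1) (v' := fun _ : Unit => 1) (by simp [hu])
        (by simp [hu]) (by simp [hu]), ae_map_iff (by fun_prop) hms]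
    simp only [pairMap_apply]
    have h0 : ∀ᵐ z ∂γ, z ≠ 0 := by
      rw [ae_iff]; simpa using hγ.zero_atom
    simpa using (measurePreserving_eval (fun _ : Unit => γ) ()).quasiMeasurePreserving.ae h0
  filter_upwards [(measurePreserving_eval (fun _ : Fin d => Measure.pi fun _ : ι => γ)
    ⟨0, hd⟩).quasiMeasurePreserving.ae hrow] with Z hZ h
  apply hZ
  rw [pairMap_apply]
  exact congrArg (fun w : EuclideanSpace 𝕜 (Fin d) => w ⟨0, hd⟩) h

/-- `vecSign` fails to be odd only at `0`, which `Z u` almost surely avoids. -/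
lemma signCorr_neg_left (hγ : IsQuadraticLaw γ) (hd : 1 ≤ d) {u : ι → ℝ}
    (hu : ∑ j, u j * u j = 1) (v : ι → ℝ) : signCorr γ d (-u) v = -signCorr γ d u v := by
  rw [signCorr, signCorr, ← integral_neg]
  refine integral_congr_ae ?_
  filter_upwards [ae_mulVec_ne_zero hγ hd hu] with Z hZ
  have : signVec (-u) Z = -signVec u Z := by
    rw [signVec, signVec, ← vecSign_neg hZ]
    congr 1
    ext i
    simp
  rw [this, inner_neg_left, map_neg]

lemma integrable_signVec_inner (hγ : IsQuadraticLaw γ) (hd : 1 ≤ d) (u v : ι → ℝ) :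
    Integrable (fun Z : Fin d → ι → 𝕜 => inner 𝕜 (signVec u Z) (signVec v Z))
      (Measure.pi fun _ => Measure.pi fun _ => γ) := by
  have := hγ.isProbability
  refine Integrable.of_bound (C := 1)
    ((measurable_signVec u).aestronglyMeasurable.inner (measurable_signVec v).aestronglyMeasurable)
    (.of_forall fun Z => ?_)
  simpa [signVec, norm_vecSign hd] using norm_inner_le_norm (𝕜 := 𝕜) (signVec u Z) (signVec v Z)

/-- Averages of Gram forms of sign vectors. -/
lemma integral_sum_signVec (hγ : IsQuadraticLaw γ) (hd : 1 ≤ d) {s : Type} [Fintype s]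
    (u : s → ι → ℝ) (c : s → s → ℝ) :
    ∫ Z : Fin d → ι → 𝕜, ∑ a, ∑ b, c a b * RCLike.re (inner 𝕜 (signVec (u a) Z) (signVec (u b) Z))
      ∂(Measure.pi fun _ => Measure.pi fun _ => γ) = ∑ a, ∑ b, c a b * signCorr γ d (u a) (u b) := by
  have hint := fun a b => (integrable_signVec_inner hγ hd (u a) (u b)).re.const_mul (c a b)
  rw [integral_finsetSum _ fun a _ => integrable_finsetSum _ fun b _ => hint a b]
  refine Finset.sum_congr rfl fun a _ => ?_
  rw [integral_finsetSum _ fun b _ => hint a b]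
  refine Finset.sum_congr rfl fun b _ => ?_
  rw [integral_const_mul, signCorr]

/-- The form is the expectation of `‖∑ c_a sgn (Z u_a)‖²`. -/
lemma signCorr_posDef (hγ : IsQuadraticLaw γ) (hd : 1 ≤ d) {s : Type} [Fintype s]
    (u : s → ι → ℝ) (c : s → ℝ) : 0 ≤ ∑ a, ∑ b, c a * c b * signCorr γ d (u a) (u b) := by
  rw [← integral_sum_signVec hγ hd]
  refine integral_nonneg fun Z => ?_
  have : ∑ a, ∑ b, c a * c b * RCLike.re (inner 𝕜 (signVec (u a) Z) (signVec (u b) Z)) =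
      RCLike.re (inner 𝕜 (∑ a, (c a : 𝕜) • signVec (u a) Z) (∑ a, (c a : 𝕜) • signVec (u a) Z)) := by
    simp only [sum_inner, inner_sum, map_sum, inner_smul_left, inner_smul_right, RCLike.conj_ofReal,
      RCLike.re_ofReal_mul, mul_assoc, Finset.mul_sum]
    rw [Finset.sum_comm]
    exact Finset.sum_congr rfl fun a _ => Finset.sum_congr rfl fun b _ => mul_left_comm _ _ _
  simp only [this, Pi.zero_apply]
  exact inner_self_nonneg

end Sign

/-! ### Rounding -/

section Rounding

variable {𝕜 : Type} [RCLike 𝕜] [MeasurableSpace 𝕜] [BorelSpace 𝕜] {d : ℕ} {γ : Measure 𝕜}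

/-- The sign correlation as a function of the inner product. -/
noncomputable def signPhi (γ : Measure 𝕜) (d : ℕ) (t : ℝ) : ℝ :=
  signCorr γ d ![1, 0] ![t, √(1 - t ^ 2)]

lemma signCorr_eq_signPhi (hγ : IsQuadraticLaw γ) {ι : Type} [Fintype ι] {u v : ι → ℝ}
    (hu : ∑ j, u j * u j = 1) (hv : ∑ j, v j * v j = 1) :
    signCorr γ d u v = signPhi γ d (∑ j, u j * v j) := by
  have h1 : (∑ j, u j * v j) ^ 2 ≤ 1 := by
    refine (Finset.sum_mul_sq_le_sq_mul_sq _ _ _).trans ?_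
    simp only [sq, hu, hv, mul_one, le_refl]
  have h2 := Real.mul_self_sqrt (sub_nonneg.2 h1)
  refine signCorr_congr hγ (by simp [hu]) (by simp) ?_
  simp only [Fin.sum_univ_two, Matrix.cons_val_zero, Matrix.cons_val_one, hv, h2]
  ring

lemma signPhi_posDef (hγ : IsQuadraticLaw γ) (hd : 1 ≤ d) : SpherePosDef (signPhi γ d) := by
  intro s ι _ _ u hu c
  simp only [sq] at hu
  convert signCorr_posDef hγ hd u c using 5 with a _ b _
  exact (signCorr_eq_signPhi hγ (hu a) (hu b)).symm

lemma signPhi_one (hγ : IsQuadraticLaw γ) (hd : 1 ≤ d) : signPhi γ d 1 = 1 := by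
  have := signCorr_eq_signPhi (d := d) hγ (u := fun _ : Unit => 1) (v := fun _ => 1) (by simp)
    (by simp)
  rw [signCorr_self hγ hd] at this
  simpa using this.symm

lemma signPhi_neg (hγ : IsQuadraticLaw γ) (hd : 1 ≤ d) {t : ℝ} (ht : |t| ≤ 1) :
    signPhi γ d (-t) = -signPhi γ d t := by
  have hs : √(1 - t ^ 2) * √(1 - t ^ 2) = 1 - t ^ 2 :=
    Real.mul_self_sqrt (by nlinarith [sq_abs t, abs_nonneg t])
  have h1 := signCorr_eq_signPhi (d := d) hγ (u := -![1, 0]) (v := ![t, √(1 - t ^ 2)])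
    (by simp) (by simp [hs]; ring)
  rw [signCorr_neg_left hγ hd (by simp)] at h1
  simpa [signPhi] using h1.symm

lemma signPhi_zero (hγ : IsQuadraticLaw γ) (hd : 1 ≤ d) : signPhi γ d 0 = 0 := by
  have := signPhi_neg hγ hd (t := 0) (by simp)
  rw [neg_zero] at this
  linarith

lemma signPhi_nonneg (hγ : IsQuadraticLaw γ) (hd : 1 ≤ d) {t : ℝ} (h0 : 0 ≤ t) (h1 : t ≤ 1) :
    0 ≤ signPhi γ d t :=
  (signPhi_posDef hγ hd).nonneg (signPhi_one hγ hd) h0 h1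

lemma signPhi_le_self (hγ : IsQuadraticLaw γ) (hd : 1 ≤ d) {t : ℝ} (h0 : 0 ≤ t) (h1 : t ≤ 1) :
    signPhi γ d t ≤ t :=
  (signPhi_posDef hγ hd).le_self (signPhi_zero hγ hd) (signPhi_one hγ hd) h0 h1

/-- The approximation ratio of the rounding scheme. -/
noncomputable def signAlpha (γ : Measure 𝕜) (d : ℕ) : ℝ :=
  ⨅ x : Set.Icc (0 : ℝ) 1, (1 + signPhi γ d (x : ℝ)) / (1 + (x : ℝ))

lemma signAlpha_pos (hγ : IsQuadraticLaw γ) (hd : 1 ≤ d) : 0 < signAlpha γ d := by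
  have : Nonempty (Set.Icc (0 : ℝ) 1) := ⟨⟨0, by simp⟩⟩
  -- On `[0, 1]` the numerator is at least `1` and the denominator at most `2`.
  refine lt_of_lt_of_le (by norm_num : (0 : ℝ) < 1 / 2) (le_ciInf fun x => ?_)
  have h := signPhi_nonneg hγ hd x.2.1 x.2.2
  have h1 := x.2.1
  have h2 := x.2.2
  rw [div_le_div_iff₀ (by norm_num) (by linarith)]
  linarith

lemma signAlpha_le (hγ : IsQuadraticLaw γ) (hd : 1 ≤ d) {x : ℝ} (h0 : 0 ≤ x) (h1 : x ≤ 1) :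
    signAlpha γ d * (1 + x) ≤ 1 + signPhi γ d x := by
  rw [← le_div_iff₀ (by linarith)]
  refine ciInf_le (f := fun x : Set.Icc (0 : ℝ) 1 => (1 + signPhi γ d (x : ℝ)) / (1 + (x : ℝ)))
    ⟨0, ?_⟩ (⟨x, h0, h1⟩ : Set.Icc (0 : ℝ) 1)
  rintro _ ⟨y, rfl⟩
  have h := signPhi_nonneg hγ hd y.2.1 y.2.2
  have h1 := y.2.1
  positivity

/-- For `t ≥ 0`, the point `x = 0` of the infimum gives `α ≤ 1`, so `α (1 - t) ≤ 1 - t ≤ 1 - φ(t)`.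
For `t ≤ 0`, take `x = -t`. -/
lemma signAlpha_mul_le (hγ : IsQuadraticLaw γ) (hd : 1 ≤ d) {t : ℝ} (ht : |t| ≤ 1) :
    signAlpha γ d * (1 - t) ≤ 1 - signPhi γ d t := by
  obtain ⟨ht1, ht2⟩ := abs_le.1 ht
  rcases le_total 0 t with h0 | h0
  · have ha : signAlpha γ d ≤ 1 := by
      have := signAlpha_le hγ hd le_rfl zero_le_one
      rwa [signPhi_zero hγ hd, add_zero, mul_one] at this
    have := signPhi_le_self hγ hd h0 ht2
    nlinarith
  · have := signAlpha_le hγ hd (x := -t) (by linarith) (by linarith)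
    rw [signPhi_neg hγ hd ht] at this
    linarith

/-- Random rounding of unit vectors to rank `d`. -/
lemma signAlpha_mul_cutValue_le (hγ : IsQuadraticLaw γ) (hd : 1 ≤ d) {n m : ℕ}
    {A : Matrix (Fin n) (Fin n) ℝ} (hs : A.IsSymm) (hA : ∀ i j, 0 ≤ A i j)
    {x : Fin n → EuclideanSpace 𝕜 (Fin m)} (hx : ∀ i, ‖x i‖ = 1) :
    signAlpha γ d * cutValue 𝕜 A x ≤ gammaRank 𝕜 d (toField 𝕜 (laplacian A)) := by
  have := hγ.isProbability
  -- Passing to real coordinates turns `Re ⟨x_i, x_j⟩` into a real inner product, so `φ` is needed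
  -- at real arguments only.
  let u : Fin n → Fin m × Bool → ℝ := fun i k =>
    if k.2 then RCLike.re (x i k.1) else RCLike.im (x i k.1)
  have hu : ∀ i j, ∑ k, u i k * u j k = RCLike.re (inner 𝕜 (x i) (x j)) := by
    intro i j
    simp only [u, PiLp.inner_apply, Fintype.sum_prod_type, Fintype.sum_bool, map_sum]
    exact Finset.sum_congr rfl fun k _ => by simp [RCLike.inner_apply]; ring
  have hu1 : ∀ i, ∑ k, u i k * u i k = 1 := fun i => by
    rw [hu, inner_self_eq_norm_sq_to_K, hx]; simp
  have h1 : ∀ Z : Fin d → Fin m × Bool → 𝕜,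
      ∑ i, ∑ j, -A i j * RCLike.re (inner 𝕜 (signVec (u i) Z) (signVec (u j) Z)) ≤
        gammaRank 𝕜 d (toField 𝕜 (laplacian A)) - ∑ i, ∑ j, A i j := fun Z => by
    have := cutValue_le_gammaRank hs hA (x := fun i => signVec (u i) Z)
      fun i => norm_vecSign hd _
    simp only [cutValue, mul_sub, mul_one, Finset.sum_sub_distrib] at this
    simp only [neg_mul, Finset.sum_neg_distrib]
    linarith
  have h2 := integral_mono (μ := Measure.pi fun _ : Fin d => Measure.pi fun _ : Fin m × Bool => γ)
    (integrable_finsetSum _ fun a _ => integrable_finsetSum _ fun b _ =>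
      (integrable_signVec_inner hγ hd (u a) (u b)).re.const_mul (-A a b))
    (integrable_const _) h1
  rw [integral_sum_signVec hγ hd u fun i j => -A i j] at h2
  simp only [integral_const, probReal_univ, one_smul] at h2
  have h3 : signAlpha γ d * cutValue 𝕜 A x ≤
      ∑ i, ∑ j, A i j * (1 - signCorr γ d (u i) (u j)) := by
    rw [cutValue, Finset.mul_sum]
    refine Finset.sum_le_sum fun i _ => ?_
    rw [Finset.mul_sum]
    refine Finset.sum_le_sum fun j _ => ?_
    rw [signCorr_eq_signPhi hγ (hu1 i) (hu1 j), hu, mul_left_comm]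
    exact mul_le_mul_of_nonneg_left
      (signAlpha_mul_le hγ hd (re_inner_le_one (hx i) (hx j))) (hA i j)
  refine h3.trans ?_
  simp only [neg_mul, Finset.sum_neg_distrib] at h2
  simp only [mul_sub, mul_one, Finset.sum_sub_distrib]
  linarith

lemma inv_signAlpha_mem_gwBounds (hγ : IsQuadraticLaw γ) (hd : 1 ≤ d) :
    (signAlpha γ d)⁻¹ ∈ gwBounds 𝕜 d := by
  have hpos := signAlpha_pos hγ hd
  refine ⟨inv_pos.2 hpos, ?_⟩
  rintro n L ⟨A, hs, -, hA, rfl⟩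
  refine gammaRank_le hs hA (mul_nonneg (inv_nonneg.2 hpos.le) (gammaRank_nonneg _ _)) fun x hx => ?_
  rw [inv_mul_eq_div, le_div_iff₀' hpos]
  exact signAlpha_mul_cutValue_le hγ hd hs hA hx

end Rounding

/-! ### Gaussian laws -/

section Density

lemma pi_withDensity_ofReal {ι X : Type*} [Fintype ι] [MeasurableSpace X] (μ : Measure X)
    [SigmaFinite μ] {f : X → ℝ} (hf0 : ∀ x, 0 ≤ f x) (hf : Integrable f μ) :
    Measure.pi (fun _ : ι => μ.withDensity fun x => ENNReal.ofReal (f x)) =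
      (Measure.pi fun _ : ι => μ).withDensity fun x => ENNReal.ofReal (∏ i, f (x i)) := by
  have : IsFiniteMeasure (μ.withDensity fun x => ENNReal.ofReal (f x)) :=
    isFiniteMeasure_withDensity_ofReal hf.2
  refine Measure.pi_eq fun s hs => ?_
  -- Stated for a family `ν` because it is applied to the restrictions of `μ` to the sides of a box.
  have hprod : ∀ (ν : ι → Measure X) [∀ i, SigmaFinite (ν i)], (∀ i, Integrable f (ν i)) →
      ∫⁻ x, ENNReal.ofReal (∏ i, f (x i)) ∂(Measure.pi ν) =
        ∏ i, ∫⁻ x, ENNReal.ofReal (f x) ∂(ν i) := by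
    intro ν _ hν
    rw [← ofReal_integral_eq_lintegral_ofReal (Integrable.fintype_prod_dep hν)
      (.of_forall fun x => Finset.prod_nonneg fun i _ => hf0 _), integral_fintype_prod_eq_prod,
      ENNReal.ofReal_prod_of_nonneg fun i _ => integral_nonneg hf0]
    exact Finset.prod_congr rfl fun i _ =>
      ofReal_integral_eq_lintegral_ofReal (hν i) (.of_forall hf0)
  rw [withDensity_apply _ (MeasurableSet.univ_pi hs), Measure.restrict_pi_pi,
    hprod _ fun i => hf.restrict]
  exact Finset.prod_congr rfl fun i _ => (withDensity_apply _ (hs i)).symm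

lemma pi_pi_withDensity_ofReal {ι κ X : Type*} [Fintype ι] [Fintype κ] [MeasureSpace X]
    [SigmaFinite (volume : Measure X)] {f : X → ℝ} (hf0 : ∀ x, 0 ≤ f x) (hf : Integrable f) :
    Measure.pi (fun _ : ι => Measure.pi fun _ : κ => volume.withDensity fun x =>
      ENNReal.ofReal (f x)) =
      (volume : Measure (ι → κ → X)).withDensity fun Z =>
        ENNReal.ofReal (∏ i, ∏ j, f (Z i j)) := by
  rw [pi_withDensity_ofReal _ hf0 hf, pi_withDensity_ofReal (f := fun z : κ → X => ∏ j, f (z j)) _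
    (fun z => Finset.prod_nonneg fun j _ => hf0 _) (Integrable.fintype_prod fun _ => hf)]
  rfl

lemma signCorr_withDensity {𝕜 : Type} [RCLike 𝕜] [MeasureSpace 𝕜] [BorelSpace 𝕜]
    [SigmaFinite (volume : Measure 𝕜)] {ι : Type} [Fintype ι] {f : 𝕜 → ℝ} (hf0 : ∀ x, 0 ≤ f x)
    (hfm : Measurable f) (hf : Integrable f)
    (hγ : IsQuadraticLaw (volume.withDensity fun x => ENNReal.ofReal (f x))) {d : ℕ} (hd : 1 ≤ d)
    (u v : ι → ℝ) :
    signCorr (volume.withDensity fun x => ENNReal.ofReal (f x)) d u v =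
      RCLike.re (∫ Z : Fin d → ι → 𝕜,
        ((∏ i, ∏ j, f (Z i j) : ℝ) : 𝕜) * inner 𝕜 (signVec u Z) (signVec v Z)) := by
  rw [signCorr, integral_re (integrable_signVec_inner hγ hd u v), pi_pi_withDensity_ofReal hf0 hf,
    integral_withDensity_eq_integral_toReal_smul (by fun_prop) (.of_forall fun _ => by simp)]
  congr 1
  refine integral_congr_ae (.of_forall fun Z => ?_)
  simp only
  rw [ENNReal.toReal_ofReal (Finset.prod_nonneg fun i _ => Finset.prod_nonneg fun j _ => hf0 _),
    RCLike.real_smul_eq_coe_mul]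

end Density

section Real

open ProbabilityTheory

lemma isQuadraticLaw_gaussianReal : IsQuadraticLaw (gaussianReal 0 1) where
  isProbability := inferInstance
  zero_atom := by
    have := nullSingletonClass_gaussianReal (μ := 0) (v := 1) one_ne_zero
    exact measure_singleton 0
  charFunDual_eq := by
    refine ⟨LinearMap.mk₂ ℝ (fun l l' => -(l 1 * l' 1) / 2) ?_ ?_ ?_ ?_, fun l => ?_⟩
    · intros; simp; ring
    · intros; simp; ring
    · intros; simp; ring
    · intros; simp; ring
    · have hl : ∀ v : ℝ, l v = l 1 * v := fun v => by
        have := l.map_smul v 1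
        rwa [smul_eq_mul, mul_one, smul_eq_mul, mul_comm] at this
      have h := charFun_gaussianReal (μ := 0) (v := 1) (l 1)
      rw [charFun_apply_real] at h
      have h2 : charFunDual (gaussianReal 0 1) l = ∫ x, Complex.exp (l 1 * x * Complex.I)
          ∂gaussianReal 0 1 := by
        rw [charFunDual_apply]
        exact integral_congr_ae (.of_forall fun x => by simp only; rw [hl x, Complex.ofReal_mul])
      rw [h2, h]
      simp
      ring_nf

lemma signPhi_gaussianReal {d : ℕ} (hd : 1 ≤ d) (x : ℝ) :
    signPhi (gaussianReal 0 1) d x = phiReal d x := by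
  have hγ := isQuadraticLaw_gaussianReal
  have hdens : gaussianReal 0 1 =
      volume.withDensity fun x => ENNReal.ofReal (gaussianPDFReal 0 1 x) :=
    gaussianReal_of_var_ne_zero 0 one_ne_zero
  rw [hdens] at hγ ⊢
  rw [signPhi, signCorr_withDensity (gaussianPDFReal_nonneg 0 1) (measurable_gaussianPDFReal 0 1)
    (integrable_gaussianPDFReal 0 1) hγ hd, phiReal, signIntegralReal]
  simp only [RCLike.re_to_real]
  refine integral_congr_ae (.of_forall fun Z => ?_)
  have h1 : ∏ i, ∏ j, gaussianPDFReal 0 1 (Z i j) = gaussReal d 2 Z := by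
    simp only [gaussianPDFReal, Finset.prod_mul_distrib, ← Real.exp_sum, gaussReal]
    congr 1
    · simp only [Finset.prod_const, Finset.card_univ, Fintype.card_fin, NNReal.coe_one, mul_one]
      rw [inv_pow, Real.sq_sqrt (by positivity), inv_pow, Real.rpow_neg (by positivity)]
      simp
    · congr 1
      rw [neg_div, Finset.sum_div, ← Finset.sum_neg_distrib]
      refine Finset.sum_congr rfl fun i _ => ?_
      rw [Finset.sum_div, ← Finset.sum_neg_distrib]
      simp [neg_div]
  simp only [h1]
  rw [mul_comm]
  congr 2

lemma signAlpha_gaussianReal {d : ℕ} (hd : 1 ≤ d) :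
    signAlpha (gaussianReal 0 1) d = alphaReal d := by
  simp only [signAlpha, alphaReal, signPhi_gaussianReal hd]

end Real

section Complex

/-- The density of the standard complex Gaussian law. -/
noncomputable def complexGaussianPDF (z : ℂ) : ℝ := Real.pi⁻¹ * Real.exp (-‖z‖ ^ 2)

/-- The standard complex Gaussian law. -/
noncomputable def complexGaussian : Measure ℂ :=
  volume.withDensity fun z => ENNReal.ofReal (complexGaussianPDF z)

lemma complexGaussianPDF_nonneg (z : ℂ) : 0 ≤ complexGaussianPDF z := by
  unfold complexGaussianPDF; positivity

lemma measurable_complexGaussianPDF : Measurable complexGaussianPDF := by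
  unfold complexGaussianPDF; fun_prop

lemma integral_complexGaussianPDF : ∫ z, complexGaussianPDF z = 1 := by
  have h := GaussianFourier.integral_rexp_neg_mul_sq_norm (V := ℂ) zero_lt_one
  simp only [neg_mul, one_mul, Complex.finrank_real_complex] at h
  simp only [complexGaussianPDF, integral_const_mul]
  rw [h]
  simp [Real.pi_ne_zero]

lemma integrable_complexGaussianPDF : Integrable complexGaussianPDF := by
  -- A non-integrable function has integral `0` by default, so the value `1` forces integrability.
  by_contra h
  have := integral_complexGaussianPDF
  rw [integral_undef h] at this
  exact zero_ne_one this

/-- `l` is the real inner product with `w = l(1) + i l(i)`, and the Gaussian integral gives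
`exp(-|w|²/4)`. -/
lemma charFunDual_complexGaussian (l : StrongDual ℝ ℂ) :
    charFunDual complexGaussian l =
      Complex.exp ((-(l 1 * l 1 + l Complex.I * l Complex.I) / 4 : ℝ) : ℂ) := by
  have hl : ∀ v : ℂ, l v = inner ℝ (⟨l 1, l Complex.I⟩ : ℂ) v := fun v => by
    have hv : v = v.re • (1 : ℂ) + v.im • Complex.I := by simp
    conv_lhs => rw [hv, map_add, map_smul, map_smul]
    simp [Complex.inner]
  have h := GaussianFourier.integral_cexp_neg_mul_sq_norm_add (V := ℂ) (b := 1) (by simp) Complex.I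
    ⟨l 1, l Complex.I⟩
  rw [charFunDual_apply, complexGaussian, integral_withDensity_eq_integral_toReal_smul
    measurable_complexGaussianPDF.ennreal_ofReal (.of_forall fun _ => by simp)]
  have h2 : ∀ v : ℂ, (ENNReal.ofReal (complexGaussianPDF v)).toReal •
      Complex.exp (l v * Complex.I) = ((Real.pi⁻¹ : ℝ) : ℂ) *
        Complex.exp (-1 * (‖v‖ : ℂ) ^ 2 +
          Complex.I * ((inner ℝ (⟨l 1, l Complex.I⟩ : ℂ) v : ℝ) : ℂ)) := fun v => by
    rw [ENNReal.toReal_ofReal (complexGaussianPDF_nonneg v), hl, Complex.exp_add,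
      complexGaussianPDF, Complex.real_smul]
    push_cast
    ring_nf
  simp only [h2, integral_const_mul, h]
  have h3 : (‖(⟨l 1, l Complex.I⟩ : ℂ)‖ : ℂ) ^ 2 =
      ((l 1 * l 1 + l Complex.I * l Complex.I : ℝ) : ℂ) := by
    rw [← Complex.ofReal_pow, Complex.sq_norm, Complex.normSq_mk]
  rw [h3, Complex.finrank_real_complex, ← mul_assoc]
  have h4 : ((Real.pi⁻¹ : ℝ) : ℂ) * ((Real.pi : ℂ) / 1) ^ (((2 : ℕ) : ℂ) / 2) = 1 := by
    simp [Real.pi_ne_zero]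
  rw [h4, one_mul, Complex.I_sq]
  congr 1
  push_cast
  ring

lemma isQuadraticLaw_complexGaussian : IsQuadraticLaw complexGaussian where
  isProbability := by
    refine ⟨?_⟩
    rw [complexGaussian, withDensity_apply _ MeasurableSet.univ, Measure.restrict_univ,
      ← ofReal_integral_eq_lintegral_ofReal integrable_complexGaussianPDF
        (.of_forall complexGaussianPDF_nonneg), integral_complexGaussianPDF, ENNReal.ofReal_one]
  zero_atom := withDensity_absolutelyContinuous _ _ (measure_singleton 0)
  charFunDual_eq := by
    refine ⟨LinearMap.mk₂ ℝ
      (fun l l' => -(l 1 * l' 1 + l Complex.I * l' Complex.I) / 4) ?_ ?_ ?_ ?_,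
      charFunDual_complexGaussian⟩
    · intros; simp; ring
    · intros; simp; ring
    · intros; simp; ring
    · intros; simp; ring

lemma signPhi_complexGaussian {d : ℕ} (hd : 1 ≤ d) (x : ℝ) :
    signPhi complexGaussian d x = (phiComplex d (x : ℂ)).re := by
  have hγ := isQuadraticLaw_complexGaussian
  rw [complexGaussian] at hγ ⊢
  rw [signPhi, signCorr_withDensity complexGaussianPDF_nonneg measurable_complexGaussianPDF
    integrable_complexGaussianPDF hγ hd, phiComplex, signIntegralComplex]
  simp only [RCLike.re_to_complex]
  congr 1
  refine integral_congr_ae (.of_forall fun Z => ?_)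
  have h1 : ∏ i, ∏ j, complexGaussianPDF (Z i j) = gaussComplex d 2 Z := by
    simp only [complexGaussianPDF, Finset.prod_mul_distrib, ← Real.exp_sum, gaussComplex]
    congr 1
    · simp only [Finset.prod_const, Finset.card_univ, Fintype.card_fin]
      rw [inv_pow, inv_pow, Real.rpow_neg (by positivity), ← pow_mul, ← Nat.cast_mul,
        Real.rpow_natCast, mul_comm]
    · simp only [← Finset.sum_neg_distrib]
  simp only [h1]
  rw [mul_comm]
  congr 2
  simp [signVec, matVec]

lemma signAlpha_complexGaussian {d : ℕ} (hd : 1 ≤ d) :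
    signAlpha complexGaussian d = alphaComplex d := by
  simp only [signAlpha, alphaComplex, signPhi_complexGaussian hd]

end Complex

/-! ### The Goemans–Williamson constant as a conic constant -/

section Constants

variable {𝕜 : Type} [RCLike 𝕜] {d : ℕ}

/-- The Laplacian of a single edge has positive rank-`d` seminorm, witnessed by `e, -e`. This keeps
the infimum `gwConst` away from `0`. -/
lemma one_le_of_mem_gwBounds (hd : 1 ≤ d) {K : ℝ} (hK : K ∈ gwBounds 𝕜 d) : 1 ≤ K := by
  have hs : (!![0, 1; 1, 0] : Matrix (Fin 2) (Fin 2) ℝ).IsSymm := by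
    ext i j; fin_cases i <;> fin_cases j <;> rfl
  have hA : ∀ i j, 0 ≤ (!![0, 1; 1, 0] : Matrix (Fin 2) (Fin 2) ℝ) i j := by
    intro i j; fin_cases i <;> fin_cases j <;> simp
  have h0 : ∀ i, (!![0, 1; 1, 0] : Matrix (Fin 2) (Fin 2) ℝ) i i = 0 := by
    intro i; fin_cases i <;> rfl
  have he := norm_vecSign hd (0 : EuclideanSpace 𝕜 (Fin d))
  set e := vecSign (0 : EuclideanSpace 𝕜 (Fin d))
  have hpos : 0 < gammaRank 𝕜 d (toField 𝕜 (laplacian !![0, 1; 1, 0])) := by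
    refine lt_of_lt_of_le ?_ (cutValue_le_gammaRank hs hA (x := ![e, -e]) ?_)
    · simp [cutValue, Fin.sum_univ_two, inner_self_eq_norm_sq_to_K, he]
    · intro i; fin_cases i <;> simp [he]
  have h := (gammaRank_le_gammaNorm (𝕜 := 𝕜) (p := d) hs hA).trans
    (hK.2 2 _ ⟨_, hs, h0, hA, rfl⟩)
  exact le_of_mul_le_mul_right (by rwa [one_mul]) hpos

lemma isLeast_gwConst (hd : 1 ≤ d) (hne : (gwBounds 𝕜 d).Nonempty) :
    IsLeast (gwBounds 𝕜 d) (gwConst 𝕜 d) := by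
  refine ⟨⟨zero_lt_one.trans_le (le_csInf hne fun K hK => one_le_of_mem_gwBounds hd hK),
    fun n L hL => ?_⟩, fun K hK => csInf_le ⟨1, fun K hK => one_le_of_mem_gwBounds hd hK⟩ hK⟩
  -- If the rank-`d` seminorm vanishes, any admissible `K` already forces `‖L‖_γ ≤ 0`.
  rcases (gammaRank_nonneg d (toField 𝕜 L)).eq_or_lt with h | h
  · obtain ⟨K, hK⟩ := hne
    simpa [← h] using hK.2 n L hL
  · rw [← div_le_iff₀ h]
    exact le_csInf hne fun K hK => (div_le_iff₀ h).2 (hK.2 n L hL)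

lemma conicConstTop_laplacian (hd : 1 ≤ d) (hne : (gwBounds 𝕜 d).Nonempty) :
    conicConstTop 𝕜 (laplacianFamily 𝕜) d = ENNReal.ofReal (gwConst 𝕜 d) := by
  have hleast := isLeast_gwConst hd hne
  have hle : conicConstTop 𝕜 (laplacianFamily 𝕜) d ≤ ENNReal.ofReal (gwConst 𝕜 d) := by
    refine iSup_le fun n => iSup₂_le ?_
    rintro _ ⟨L, hL, rfl⟩
    refine ENNReal.div_le_of_le_mul ?_
    rw [← ENNReal.ofReal_mul hleast.1.1.le]
    exact ENNReal.ofReal_le_ofReal (hleast.1.2 n L hL)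
  refine hle.antisymm ?_
  have htop : conicConstTop 𝕜 (laplacianFamily 𝕜) d ≠ ⊤ := ne_top_of_le_ne_top (by simp) hle
  rw [ENNReal.ofReal_le_iff_le_toReal htop]
  -- Adding `ε` secures the strict positivity that membership in `gwBounds` demands.
  refine le_of_forall_pos_le_add fun ε hε => hleast.2 ⟨by positivity, fun n L hL => ?_⟩
  rcases (gammaRank_nonneg d (toField 𝕜 L)).eq_or_lt with h | h
  · simpa [← h] using hleast.1.2 n L hL
  · have h1 : ENNReal.ofReal (gammaNorm 𝕜 (toField 𝕜 L)) /
        ENNReal.ofReal (gammaRank 𝕜 d (toField 𝕜 L)) ≤ conicConstTop 𝕜 (laplacianFamily 𝕜) d :=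
      le_iSup_of_le n (le_iSup₂_of_le (toField 𝕜 L) ⟨L, hL, rfl⟩ le_rfl)
    rw [← ENNReal.ofReal_div_of_pos h, ENNReal.ofReal_le_iff_le_toReal htop] at h1
    rw [← div_le_iff₀ h]
    linarith

/-- The constants increase with `p`, so the limit is a supremum. At size `n` the `γ`-seminorm is
attained at `p = n` and bounds every other rank. -/
lemma tendsto_conicConst_laplacian (d : ℕ) :
    Tendsto (fun p : ℕ => conicConst 𝕜 (laplacianFamily 𝕜) d p) atTop
      (𝓝 (conicConstTop 𝕜 (laplacianFamily 𝕜) d)) := by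
  have hmono : Monotone fun p : ℕ => conicConst 𝕜 (laplacianFamily 𝕜) d p := by
    intro p q hpq
    refine iSup_mono fun n => iSup₂_mono ?_
    rintro _ ⟨L, ⟨A, hs, -, hA, rfl⟩, rfl⟩
    exact ENNReal.div_le_div_right (ENNReal.ofReal_le_ofReal (gammaRank_mono hpq hs hA)) _
  convert tendsto_atTop_iSup hmono using 2
  apply le_antisymm
  · refine iSup_le fun n => iSup₂_le fun L hL => ?_
    exact le_iSup_of_le n (le_iSup_of_le n (le_iSup₂_of_le L hL le_rfl))
  · refine iSup_le fun p => iSup_mono fun n => iSup₂_mono ?_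
    rintro _ ⟨L, ⟨A, hs, -, hA, rfl⟩, rfl⟩
    exact ENNReal.div_le_div_right (ENNReal.ofReal_le_ofReal (gammaRank_le_gammaNorm hs hA)) _

lemma gwConst_characterization [MeasurableSpace 𝕜] [BorelSpace 𝕜] {γ : Measure 𝕜}
    (hγ : IsQuadraticLaw γ) (hd : 1 ≤ d) :
    IsLeast (gwBounds 𝕜 d) (gwConst 𝕜 d) ∧
      conicConstTop 𝕜 (laplacianFamily 𝕜) d = ENNReal.ofReal (gwConst 𝕜 d) ∧
      Tendsto (fun p : ℕ => conicConst 𝕜 (laplacianFamily 𝕜) d p) atTop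
        (𝓝 (ENNReal.ofReal (gwConst 𝕜 d))) ∧
      gwConst 𝕜 d ≤ 1 / signAlpha γ d := by
  have hmem := inv_signAlpha_mem_gwBounds hγ hd
  have hleast := isLeast_gwConst hd ⟨_, hmem⟩
  have htop := conicConstTop_laplacian hd ⟨_, hmem⟩
  exact ⟨hleast, htop, htop ▸ tendsto_conicConst_laplacian d, by
    simpa only [one_div] using hleast.2 hmem⟩

end Constants

end GW

theorem proposition5p7 (d : ℕ) (hd : 1 ≤ d) :
    -- over the reals
    (IsLeast (GW.gwBounds ℝ d) (GW.gwConst ℝ d) ∧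
      GW.conicConstTop ℝ (GW.laplacianFamily ℝ) d = ENNReal.ofReal (GW.gwConst ℝ d) ∧
      Tendsto (fun p : ℕ => GW.conicConst ℝ (GW.laplacianFamily ℝ) d p) atTop
        (𝓝 (ENNReal.ofReal (GW.gwConst ℝ d))) ∧
      GW.gwConst ℝ d ≤ 1 / GW.alphaReal d) ∧
    -- over the complex numbers
    (IsLeast (GW.gwBounds ℂ d) (GW.gwConst ℂ d) ∧
      GW.conicConstTop ℂ (GW.laplacianFamily ℂ) d = ENNReal.ofReal (GW.gwConst ℂ d) ∧
      Tendsto (fun p : ℕ => GW.conicConst ℂ (GW.laplacianFamily ℂ) d p) atTop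
        (𝓝 (ENNReal.ofReal (GW.gwConst ℂ d))) ∧
      GW.gwConst ℂ d ≤ 1 / GW.alphaComplex d) ∧
    -- relation between the two fields
    GW.gwConst ℂ d = GW.gwConst ℝ (2 * d) := by
  refine ⟨?_, ?_, ?_⟩
  · rw [← GW.signAlpha_gaussianReal hd]
    exact GW.gwConst_characterization GW.isQuadraticLaw_gaussianReal hd
  · rw [← GW.signAlpha_complexGaussian hd]
    exact GW.gwConst_characterization GW.isQuadraticLaw_complexGaussian hd
  · rw [GW.gwConst, GW.gwConst, GW.gwBounds_complex_eq]
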